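/- Let $q$ be a prime power and let $m>1$ be an integer. Let $\mathcal X$ be a smooth absolutely irreducible algebraic curve over $\mathbb F_{q^m}$ with function field $F$ (an algebraic function field of one variable with full constant field $\mathbb F_{q^m}$). Let $P_1,\dots,P_n$ be pairwise distinct places of degree one of $F$, put $D=P_1+\dots+P_n$ (so $n=\deg D$), and let $G$ be a divisor of $F$ whose support is disjoint from that of $D$. Let $$\mathscr L(G)=\{f\in F\setminus\{0\} : v_P(f)\ge -v_P(G)\text{ for every place }P\}\cup\{0\},$$ where $v_P(G)$ is the coefficient of $P$ in $G$, and let $$C=C_L(D,G)=\{(f(P_1),\dots,f(P_n)) : f\in\mathscr L(G)\}\subseteq\mathbb F_{q^m}^n .$$ For $\boldsymbol a=(a_1,\dots,a_n)\in(\mathbb F_{q^m}^*)^n$ put $C_{\boldsymbol a}=\{(a_1x_1,\dots,a_nx_n) : \boldsymbol x\in C\}$, and let $P_C$ be the proportion of those $\boldsymbol a\in(\mathbb F_{q^m}^*)^n$ for which $C_{\boldsymbol a}$ has maximum trace dimension, i.e. $\dim_{\mathbb F_q}\operatorname{tr}(C_{\boldsymbol a})=m\dim_{\mathbb F_{q^m}}C_{\boldsymbol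 a}$, where $\operatorname{tr}$ is the trace $\mathbb F_{q^m}\to\mathbb F_q$ applied entry-wise to the codewords. If $-1\le\deg G\le \frac nm-1$, then $$P_C\;\ge\;1-\frac{1-q^{-m(\deg G+1)}}{(q-1)\,q^{\,n-m(\deg G+1)}} .$$ -/

import Mathlib

open scoped WithZero

noncomputable section

namespace AGCode

section FunctionField

variable (K F : Type*) [Field K] [Field F] [Algebra K F]

/-- A place of `F / K`, given by its valuation ring: a discrete valuation ring `𝒪` with
`K ⊆ 𝒪 ⊆ F` and fraction field `F`. (For a valuation subring of `F` the fraction field is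
automatically `F`, and a discrete valuation ring is not a field, so `𝒪 ≠ F`.) -/
@[ext]
structure Place where
  /-- The valuation ring of the place. -/
  ring : ValuationSubring F
  /-- The valuation ring contains the constants. -/
  algebraMap_mem : ∀ c : K, algebraMap K F c ∈ ring
  /-- The valuation ring is a discrete valuation ring. -/
  isDVR : IsDiscreteValuationRing ring

attribute [instance] Place.isDVR

variable {K F}

namespace Place

/-- The valuation ring of a place is a `K`-algebra. -/
instance algebraRing (P : Place K F) : Algebra K P.ring :=
  ((algebraMap K F).codRestrict P.ring P.algebraMap_mem).toAlgebra

/-- The residue field of a place, a field extension of `K`. -/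
abbrev ResidueField (P : Place K F) : Type _ := IsLocalRing.ResidueField P.ring

/-- The degree of a place: the degree of its residue field over `K`. -/
def deg (P : Place K F) : ℕ := Module.finrank K P.ResidueField

/-- The normalized discrete valuation of a place, written multiplicatively (`|f| = exp (-v_P f)`):
Mathlib's adic valuation of the maximal ideal of the valuation ring. -/
def valuation (P : Place K F) : Valuation F ℤᵐ⁰ :=
  (IsDiscreteValuationRing.maximalIdeal P.ring).valuation F

/-- The order `v_P(f)` of a function at a place (meaningful for `f ≠ 0`). -/
def ord (P : Place K F) (f : F) : ℤ := -WithZero.log (P.valuation f)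

/-- `P.HasValue f c`: the function `f` is regular at `P` and its residue class at `P` is the
constant `c`, that is, `f(P) = c`. -/
def HasValue (P : Place K F) (f : F) (c : K) : Prop :=
  ∃ h : f ∈ P.ring, IsLocalRing.residue P.ring ⟨f, h⟩ = algebraMap K P.ResidueField c

theorem hasValue_zero (P : Place K F) : P.HasValue 0 0 :=
  ⟨P.ring.zero_mem, by
    rw [map_zero]
    exact map_zero (IsLocalRing.residue P.ring)⟩

theorem HasValue.add {P : Place K F} {f g : F} {a b : K} (hf : P.HasValue f a)
    (hg : P.HasValue g b) : P.HasValue (f + g) (a + b) := by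
  obtain ⟨hf, hfa⟩ := hf
  obtain ⟨hg, hgb⟩ := hg
  refine ⟨P.ring.add_mem _ _ hf hg, ?_⟩
  rw [map_add, ← hfa, ← hgb, ← map_add]
  rfl

theorem HasValue.smul {P : Place K F} {f : F} {a : K} (c : K) (hf : P.HasValue f a) :
    P.HasValue (c • f) (c * a) := by
  obtain ⟨hf, hfa⟩ := hf
  have hc := P.algebraMap_mem c
  refine ⟨by rw [Algebra.smul_def]; exact P.ring.mul_mem _ _ hc hf, ?_⟩
  have h1 : algebraMap K P.ResidueField c = IsLocalRing.residue P.ring ⟨_, hc⟩ := rfl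
  rw [map_mul, ← hfa, h1, ← map_mul]
  congr 1
  exact Subtype.ext (Algebra.smul_def c f)

theorem neg_le_ord_iff (P : Place K F) {f : F} (hf : f ≠ 0) (n : ℤ) :
    -n ≤ P.ord f ↔ P.valuation f ≤ WithZero.exp n := by
  rw [ord, neg_le_neg_iff,
    WithZero.log_le_iff_le_exp ((Valuation.ne_zero_iff P.valuation).2 hf)]

theorem valuation_algebraMap_le_one (P : Place K F) (c : K) :
    P.valuation (algebraMap K F c) ≤ 1 :=
  (IsDiscreteValuationRing.maximalIdeal P.ring).valuation_le_one
    (⟨_, P.algebraMap_mem c⟩ : P.ring)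

end Place

variable (K F) in
/-- Divisors: formal `ℤ`-linear combinations of places. -/
abbrev Divisor : Type _ := Place K F →₀ ℤ

namespace Divisor

/-- The degree of a divisor, `deg (∑ n_P P) = ∑ n_P deg P`. -/
def deg (D : Divisor K F) : ℤ := D.sum fun P n => n * (P.deg : ℤ)

theorem riemannRoch_aux (G : Divisor K F) (f : F) :
    (f ≠ 0 → ∀ P, -G P ≤ P.ord f) ↔ ∀ P, P.valuation f ≤ WithZero.exp (G P) := by
  by_cases hf : f = 0
  · subst hf
    simp
  · exact ⟨fun h P => (P.neg_le_ord_iff hf _).1 (h hf P),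
      fun h _ P => (P.neg_le_ord_iff hf _).2 (h P)⟩

/-- The Riemann-Roch space `ℒ(G)`: zero and the nonzero `f` with `Div f ≥ -G`, that is,
`v_P(f) ≥ -G(P)` at every place `P`. -/
def riemannRochSpace (G : Divisor K F) : Submodule K F where
  carrier := {f | f ≠ 0 → ∀ P : Place K F, -G P ≤ P.ord f}
  zero_mem' := fun h => absurd rfl h
  add_mem' := by
    intro f g hf hg
    rw [Set.mem_ofPred_eq, riemannRoch_aux] at hf hg ⊢
    exact fun P => P.valuation.map_add_le (hf P) (hg P)
  smul_mem' := by
    intro c f hf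
    rw [Set.mem_ofPred_eq, riemannRoch_aux] at hf ⊢
    intro P
    rw [Algebra.smul_def, map_mul]
    exact (mul_le_mul' (P.valuation_algebraMap_le_one c) (hf P)).trans_eq (one_mul _)

end Divisor

/-- The functional algebraic geometry code `C_L(D, G)`, for `D = P 0 + ⋯ + P (n - 1)`: the vectors
`(f(P 0), …, f(P (n - 1)))` with `f ∈ ℒ(G)`. -/
def functionalCode {n : ℕ} (P : Fin n → Place K F) (G : Divisor K F) :
    Submodule K (Fin n → K) where
  carrier := {x | ∃ f ∈ G.riemannRochSpace, ∀ i, (P i).HasValue f (x i)}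
  zero_mem' := ⟨0, Submodule.zero_mem _, fun i => (P i).hasValue_zero⟩
  add_mem' := by
    rintro x y ⟨f, hf, hx⟩ ⟨g, hg, hy⟩
    exact ⟨f + g, Submodule.add_mem _ hf hg, fun i => (hx i).add (hy i)⟩
  smul_mem' := by
    rintro c x ⟨f, hf, hx⟩
    exact ⟨c • f, Submodule.smul_mem _ c hf, fun i => (hx i).smul c⟩

end FunctionField

section TraceCode

variable (k : Type*) {K : Type*} [Field k] [Field K] [Algebra k K] {n : ℕ}

/-- The code `C_a = {(a_1 x_1, …, a_n x_n) | x ∈ C}`. -/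
def multiplierCode (C : Submodule K (Fin n → K)) (a : Fin n → K) : Submodule K (Fin n → K) :=
  C.map (LinearMap.mulLeft K a)

/-- The trace code `tr(C)`: the image of `C` under the trace `K → k` applied entry-wise. -/
def traceCode (C : Submodule K (Fin n → K)) : Submodule k (Fin n → k) :=
  (C.restrictScalars k).map ((Algebra.trace k K).compLeft (Fin n))

/-- `C` has maximum trace dimension: `dim_k tr(C) = [K : k] · dim_K C`. -/
def HasMaxTraceDim (C : Submodule K (Fin n → K)) : Prop :=
  Module.finrank k (traceCode k C) = Module.finrank k K * Module.finrank K C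

/-- `P_C`: the proportion of the multiplier vectors `a ∈ (Kˣ)ⁿ` for which `C_a` has maximum trace
dimension. -/
def maxTraceDimProportion (C : Submodule K (Fin n → K)) : ℝ :=
  (Nat.card {a : Fin n → Kˣ // HasMaxTraceDim k (multiplierCode C fun i => (a i : K))} : ℝ) /
    Nat.card (Fin n → Kˣ)

end TraceCode

end AGCode

end

/-! Write Q = |K| = q^m and κ = deg G + 1. A multiplier vector `a` is bad only if some nonzero
codeword x satisfies Tr(a_i x_i) = 0 for all i, and then the q - 1 multiples of x by units of `k` do
so too. Hence (q - 1) times the number of bad `a` is at most the number of pairs (x, a) with x ≠ 0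
and all these traces zero. If ρ is the proportion of trace-zero elements among the units of `K`, a
word of weight w is killed by a fraction ρ^w of all `a`, so a bound on the weight enumerator at ρ is
needed (`sum_pow_weight_le`). It comes from expanding ρ^w over sets of zeros: at most (Q^κ - 1) /
Q^t nonzero codewords vanish at t given positions. The binomial sum collapses to (Q^κ - 1) q^(-n),
because (1 - ρ)/Q + ρ = 1/q is the probability that a uniform element of `K` has trace zero.

Geometry enters only through the fact that a codeword with κ zeros is zero
(`eq_zero_of_mem_functionalCode`), that is, through principal divisors having degree zero
(`exists_sum_ord_eq_zero`). When F/K(f) is separable, this is the fundamental identity Σ e·f = [F :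
K(f)] in the integral closure of K[f], applied to f and to 1/f. Otherwise f is a p-th power, `K`
being perfect, and the claim descends to its root. -/

noncomputable section

namespace AGCode

/-! ### Counting bad multipliers through the weight enumerator. -/

section Counting

variable {k K : Type*} [Field k] [Field K] [Algebra k K] {n : ℕ}

/-- The codewords of `C` vanishing on `T`. -/
def vanishingSubcode (C : Submodule K (Fin n → K)) (T : Finset (Fin n)) :
    Submodule K (Fin n → K) :=
  C ⊓ ⨅ i ∈ T, LinearMap.ker (LinearMap.proj i)

theorem mem_vanishingSubcode {C : Submodule K (Fin n → K)} {T : Finset (Fin n)}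
    {x : Fin n → K} : x ∈ vanishingSubcode C T ↔ x ∈ C ∧ ∀ i ∈ T, x i = 0 := by
  simp [vanishingSubcode]

variable [Finite K]

/-- If codewords of `C` with `κ` zeros vanish, then vanishing at `t` positions costs `t`
dimensions, up to `κ`. -/
theorem card_vanishingSubcode_sub_one_le {C : Submodule K (Fin n → K)} {κ : ℕ} (hκ : κ ≤ n)
    (hC : ∀ x ∈ C, ∀ T : Finset (Fin n), T.card = κ → (∀ i ∈ T, x i = 0) → x = 0)
    (T : Finset (Fin n)) :
    (Nat.card (vanishingSubcode C T) : ℝ) - 1 ≤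
      ((Nat.card K : ℝ) ^ κ - 1) * ((Nat.card K : ℝ)⁻¹) ^ T.card := by
  have hQ : (1 : ℝ) ≤ Nat.card K := by exact_mod_cast Nat.card_pos
  rcases le_or_gt κ T.card with h | h
  · obtain ⟨T', hT', hc⟩ := Finset.exists_subset_card_eq h
    have : vanishingSubcode C T = ⊥ := by
      rw [eq_bot_iff]
      intro x hx
      rw [mem_vanishingSubcode] at hx
      exact hC x hx.1 T' hc fun i hi => hx.2 i (hT' hi)
    rw [this]
    have h1 : (1 : ℝ) ≤ (Nat.card K : ℝ) ^ κ := one_le_pow₀ hQ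
    have : 0 ≤ ((Nat.card K : ℝ) ^ κ - 1) * ((Nat.card K : ℝ)⁻¹) ^ T.card :=
      mul_nonneg (by linarith) (by positivity)
    simpa using this
  -- Two words vanishing on `T` that agree on the remaining κ - |T| positions of `T'` differ by a
  -- word with κ zeros, so they are equal.
  · obtain ⟨T', hT', hc⟩ := Finset.exists_superset_card_eq h.le (by simpa using hκ)
    have hinj : Function.Injective
        (fun (x : vanishingSubcode C T) (i : (T' \ T : Finset (Fin n))) => x.1 i) := by
      intro x y hxy
      have hx := mem_vanishingSubcode.1 x.2
      have hy := mem_vanishingSubcode.1 y.2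
      refine Subtype.ext (sub_eq_zero.1 (hC _ (C.sub_mem hx.1 hy.1) T' hc fun i hi => ?_))
      by_cases hiT : i ∈ T
      · simp [hx.2 i hiT, hy.2 i hiT]
      · exact sub_eq_zero.2 (congrFun hxy ⟨i, by simp [hi, hiT]⟩)
    have hcard := Nat.card_le_card_of_injective _ hinj
    rw [Nat.card_fun, Nat.card_eq_fintype_card (α := (T' \ T : Finset (Fin n))), Fintype.card_coe,
      Finset.card_sdiff_of_subset hT', hc] at hcard
    have h1 : (Nat.card (vanishingSubcode C T) : ℝ) ≤ (Nat.card K : ℝ) ^ (κ - T.card) := by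
      exact_mod_cast hcard
    have h2 : (Nat.card K : ℝ) ^ κ * ((Nat.card K : ℝ)⁻¹) ^ T.card =
        (Nat.card K : ℝ) ^ (κ - T.card) := by
      rw [inv_pow, pow_sub₀ _ (by positivity) h.le]
    have h3 : ((Nat.card K : ℝ)⁻¹) ^ T.card ≤ 1 := pow_le_one₀ (by positivity) (inv_le_one_of_one_le₀ hQ)
    rw [sub_mul, h2]
    linarith

/-- The zeros of a vector. -/
def zeroSet (x : Fin n → K) : Finset (Fin n) :=
  open Classical in {i | x i = 0}

omit [Finite K] in
theorem mem_zeroSet {x : Fin n → K} {i : Fin n} : i ∈ zeroSet x ↔ x i = 0 := by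
  simp [zeroSet]

/-- A bound for the weight enumerator of `C` without the zero codeword. -/
theorem sum_pow_weight_le {C : Submodule K (Fin n → K)} {κ : ℕ} (hκ : κ ≤ n)
    (hC : ∀ x ∈ C, ∀ T : Finset (Fin n), T.card = κ → (∀ i ∈ T, x i = 0) → x = 0)
    [Fintype C] [DecidableEq C] {ρ : ℝ} (h0 : 0 ≤ ρ) (h1 : ρ ≤ 1) :
    ∑ x : C with x ≠ 0, ρ ^ (n - (zeroSet x.1).card) ≤
      ((Nat.card K : ℝ) ^ κ - 1) * ((1 - ρ) * (Nat.card K : ℝ)⁻¹ + ρ) ^ n := by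
  classical
  -- With z zeros, expand 1 = ((1 - ρ) + ρ)^z and multiply by ρ^(n - z): this is the probability
  -- that a random set, containing each position with probability 1 - ρ, lies inside the zero set.
  have hx (x : C) : ρ ^ (n - (zeroSet x.1).card) =
      ∑ T : Finset (Fin n), if T ⊆ zeroSet x.1 then (1 - ρ) ^ T.card * ρ ^ (n - T.card) else 0 := by
    rw [← Finset.sum_filter]
    have : ({T | T ⊆ zeroSet x.1} : Finset (Finset (Fin n))) = (zeroSet x.1).powerset := by
      ext; simp
    rw [this]
    have hle : (zeroSet x.1).card ≤ n := (Finset.card_le_univ _).trans (by simp)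
    have h := Finset.sum_pow_mul_eq_add_pow (1 - ρ) ρ (zeroSet x.1)
    rw [sub_add_cancel, one_pow] at h
    refine (one_mul (ρ ^ _)).symm.trans ((congrArg (· * _) h.symm).trans ?_)
    rw [Finset.sum_mul]
    refine Finset.sum_congr rfl fun T hT => ?_
    have := Finset.card_le_card (Finset.mem_powerset.1 hT)
    rw [mul_assoc, ← pow_add]
    have e : (zeroSet x.1).card - T.card + (n - (zeroSet x.1).card) = n - T.card := by omega
    rw [e]
  simp_rw [hx]
  rw [Finset.sum_comm]
  have hn := Finset.sum_pow_mul_eq_add_pow ((1 - ρ) * (Nat.card K : ℝ)⁻¹) ρ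
    (Finset.univ : Finset (Fin n))
  rw [Finset.card_univ, Fintype.card_fin, Finset.powerset_univ] at hn
  rw [← hn, Finset.mul_sum]
  refine Finset.sum_le_sum fun T _ => ?_
  rw [← Finset.sum_filter, Finset.sum_const, nsmul_eq_mul]
  have hcard : (((({x : C | x ≠ 0} : Finset C).filter
      fun x => T ⊆ zeroSet x.1).card : ℕ) : ℝ) ≤ (Nat.card (vanishingSubcode C T) : ℝ) - 1 := by
    have e : Nat.card (vanishingSubcode C T) =
        (({x : C | T ⊆ zeroSet x.1} : Finset C)).card := by
      rw [← Fintype.card_subtype, ← Nat.card_eq_fintype_card]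
      refine Nat.card_congr ⟨fun x => ⟨⟨x.1, (mem_vanishingSubcode.1 x.2).1⟩, fun i hi =>
        mem_zeroSet.2 ((mem_vanishingSubcode.1 x.2).2 i hi)⟩, fun x => ⟨x.1.1,
        mem_vanishingSubcode.2 ⟨x.1.2, fun i hi => mem_zeroSet.1 (x.2 hi)⟩⟩,
        fun _ => rfl, fun _ => rfl⟩
    have e2 : ({x : C | x ≠ 0} : Finset C).filter (fun x => T ⊆ zeroSet x.1) =
        (({x : C | T ⊆ zeroSet x.1} : Finset C)).erase 0 := by
      ext x; simp
    have h0 : (0 : C) ∈ ({x : C | T ⊆ zeroSet x.1} : Finset C) := by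
      simp [Finset.subset_iff, mem_zeroSet]
    rw [e, e2, Finset.card_erase_of_mem h0, Nat.cast_sub (Finset.card_pos.2 ⟨0, h0⟩)]
    simp
  calc _ ≤ (((Nat.card K : ℝ) ^ κ - 1) * ((Nat.card K : ℝ)⁻¹) ^ T.card) *
        ((1 - ρ) ^ T.card * ρ ^ (n - T.card)) := by
        refine mul_le_mul_of_nonneg_right
          (hcard.trans (card_vanishingSubcode_sub_one_le hκ hC T)) ?_
        have : 0 ≤ 1 - ρ := by linarith
        positivity
    _ = _ := by rw [mul_pow]; ring

/-- Multiplication by `c` carries these units onto the nonzero elements of the kernel of the trace,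
which has Q/q elements since the trace is onto. -/
theorem card_units_trace_eq_zero [Finite k] {c : K} (hc : c ≠ 0) :
    (Nat.card {u : Kˣ // Algebra.trace k K (u * c) = 0} : ℝ) =
      Nat.card K / Nat.card k - 1 := by
  have : Fintype K := Fintype.ofFinite K
  have : Module.Finite k K := Module.Finite.of_finite
  have hsurj : Function.Surjective (Algebra.trace k K) := Algebra.trace_surjective k K
  have e1 : Nat.card {u : Kˣ // Algebra.trace k K (u * c) = 0} + 1 =
      Nat.card (LinearMap.ker (Algebra.trace k K)) := by
    have h : {u : Kˣ // Algebra.trace k K (u * c) = 0} ≃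
        {z : LinearMap.ker (Algebra.trace k K) // z ≠ 0} :=
      { toFun := fun u => ⟨⟨u.1 * c, u.2⟩, fun h => mul_ne_zero u.1.ne_zero hc
          (congrArg Subtype.val h)⟩
        invFun := fun z => ⟨Units.mk0 (z.1.1 * c⁻¹) (mul_ne_zero
          (fun h => z.2 (Subtype.ext h)) (inv_ne_zero hc)), by
            have := z.1.2
            rw [LinearMap.mem_ker] at this
            simp [hc, this]⟩
        left_inv := fun u => by ext; simp [hc]
        right_inv := fun z => by ext; simp [hc] }
    rw [Nat.card_congr h]
    classical
    have : Fintype (LinearMap.ker (Algebra.trace k K)) := Fintype.ofFinite _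
    rw [Nat.card_eq_fintype_card, Nat.card_eq_fintype_card, Fintype.card_subtype_compl,
      Fintype.card_subtype_eq]
    exact Nat.sub_add_cancel Fintype.card_pos
  have e2 : Nat.card K = Nat.card k * Nat.card (LinearMap.ker (Algebra.trace k K)) := by
    rw [Submodule.card_eq_card_quotient_mul_card (LinearMap.ker (Algebra.trace k K)), mul_comm,
      Nat.card_congr ((Algebra.trace k K).quotKerEquivOfSurjective hsurj).toEquiv]
  have hk : (Nat.card k : ℝ) ≠ 0 := by exact_mod_cast Nat.card_pos.ne'
  rw [e2, ← e1]
  rw [Nat.cast_mul, mul_div_cancel_left₀ _ hk, Nat.cast_add, Nat.cast_one, add_sub_cancel_right]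

theorem card_multipliers_trace_eq_zero [Finite k] (x : Fin n → K) :
    (Nat.card {a : Fin n → Kˣ // ∀ i, Algebra.trace k K (a i * x i) = 0} : ℝ) =
      (Nat.card K / Nat.card k - 1) ^ (n - (zeroSet x).card) *
        (Nat.card Kˣ : ℝ) ^ (zeroSet x).card := by
  classical
  rw [Nat.card_congr (Equiv.subtypePiEquivPi (p := fun i (u : Kˣ) =>
    Algebra.trace k K (u * x i) = 0)), Nat.card_pi]
  push_cast
  rw [← Finset.prod_mul_prod_compl (zeroSet x), mul_comm]
  congr 1
  · rw [Finset.prod_congr rfl (g := fun _ => ((Nat.card K : ℝ) / Nat.card k - 1)),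
      Finset.prod_const, Finset.card_compl, Fintype.card_fin]
    intro i hi
    exact card_units_trace_eq_zero fun h => (Finset.mem_compl.1 hi) (mem_zeroSet.2 h)
  · rw [Finset.prod_congr rfl (g := fun _ => (Nat.card Kˣ : ℝ)), Finset.prod_const]
    intro i hi
    rw [mem_zeroSet] at hi
    simp [hi]

-- When the trace is injective on C_a, the trace code has the `k`-dimension of C_a itself, which is
-- [K : k] times its `K`-dimension.
omit [Finite K] in
theorem hasMaxTraceDim_of_injective {C : Submodule K (Fin n → K)} {a : Fin n → Kˣ}
    (h : ∀ x ∈ C, (∀ i, Algebra.trace k K (a i * x i) = 0) → x = 0) :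
    HasMaxTraceDim k (multiplierCode C fun i => (a i : K)) := by
  have hinj : Set.InjOn ((Algebra.trace k K).compLeft (Fin n))
      ((multiplierCode C fun i => (a i : K)).restrictScalars k : Set (Fin n → K)) := by
    rintro _ ⟨x, hx, rfl⟩ _ ⟨y, hy, rfl⟩ hxy
    have : x - y = 0 := h _ (C.sub_mem hx hy) fun i => by
      have := congrFun hxy i
      simp only [LinearMap.compLeft_apply, Function.comp, LinearMap.mulLeft_apply,
        Pi.mul_apply] at this
      rw [Pi.sub_apply, mul_sub, map_sub, this, sub_self]
    rw [sub_eq_zero.1 this]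
  unfold HasMaxTraceDim traceCode
  rw [Module.finrank_mul_finrank, ← LinearMap.range_domRestrict]
  exact LinearMap.finrank_range_of_inj fun x y hxy => Subtype.ext (hinj x.2 y.2 hxy)

/-- A multiplier vector failing the maximum trace dimension kills at least `|k| - 1` codewords. -/
theorem card_sub_one_le_of_not_hasMaxTraceDim [Finite k] {C : Submodule K (Fin n → K)} [Fintype C]
    {a : Fin n → Kˣ} (ha : ¬ HasMaxTraceDim k (multiplierCode C fun i => (a i : K)))
    [DecidablePred fun x : C => x ≠ 0 ∧ ∀ i, Algebra.trace k K (a i * x.1 i) = 0] :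
    Nat.card k - 1 ≤
      ({x : C | x ≠ 0 ∧ ∀ i, Algebra.trace k K (a i * x.1 i) = 0} : Finset C).card := by
  classical
  obtain ⟨x, hxC, hx, hx0⟩ : ∃ x ∈ C, (∀ i, Algebra.trace k K (a i * x i) = 0) ∧ x ≠ 0 := by
    by_contra! h
    exact ha (hasMaxTraceDim_of_injective h)
  rw [← Nat.card_units, ← Fintype.card_subtype, ← Nat.card_eq_fintype_card]
  -- The trace is `k`-linear, so every multiple of `x` by a unit of `k` is killed as well; this
  -- gives the factor q - 1 in the bound.
  refine Nat.card_le_card_of_injective (fun u : kˣ => ⟨⟨algebraMap k K u • x,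
    C.smul_mem _ hxC⟩, fun h => ?_, fun i => ?_⟩) fun u v huv => ?_
  · have h' : algebraMap k K u • x = 0 := congrArg Subtype.val h
    rw [smul_eq_zero] at h'
    exact h'.elim (by simp) hx0
  · have e : (a i : K) * (algebraMap k K u • x) i = (u : k) • (a i * x i) := by
      rw [Pi.smul_apply, smul_eq_mul, Algebra.smul_def]; ring
    change Algebra.trace k K ((a i : K) * (algebraMap k K u • x) i) = 0
    rw [e, map_smul, hx i, smul_zero]
  · have h' : algebraMap k K u • x = algebraMap k K v • x :=
      congrArg Subtype.val (congrArg Subtype.val huv)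
    exact Units.ext ((algebraMap k K).injective (smul_left_injective K hx0 h'))

/-- Double counting of the pairs (x, a) with x ≠ 0 killed by a. -/
theorem card_not_hasMaxTraceDim_mul_le [Finite k] (C : Submodule K (Fin n → K)) [Fintype C]
    [DecidableEq C] :
    (Nat.card {a : Fin n → Kˣ // ¬ HasMaxTraceDim k (multiplierCode C fun i => (a i : K))} : ℝ) *
      (Nat.card k - 1) ≤
    ∑ x : C with x ≠ 0,
      (Nat.card {a : Fin n → Kˣ // ∀ i, Algebra.trace k K (a i * x.1 i) = 0} : ℝ) := by
  classical
  have : Fintype Kˣ := Fintype.ofFinite _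
  have hk : 1 ≤ Nat.card k := Nat.card_pos
  have hc : (Nat.card k : ℝ) - 1 = ((Nat.card k - 1 : ℕ) : ℝ) := by
    rw [Nat.cast_sub hk, Nat.cast_one]
  rw [hc]
  norm_cast
  simp only [Nat.card_eq_fintype_card, Fintype.card_subtype]
  have h1 : ∑ x : C with x ≠ 0,
        ({a : Fin n → Kˣ | ∀ i, Algebra.trace k K (a i * x.1 i) = 0} : Finset _).card =
      ∑ a : Fin n → Kˣ, ({x : C | x ≠ 0 ∧ ∀ i, Algebra.trace k K (a i * x.1 i) = 0} :
        Finset C).card := by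
    simp_rw [Finset.card_filter]
    rw [Finset.sum_comm]
    refine Finset.sum_congr rfl fun a _ => ?_
    rw [Finset.sum_filter]
    exact Finset.sum_congr rfl fun x _ => by rw [ite_and]
  rw [h1, ← smul_eq_mul, ← Finset.sum_const]
  refine (Finset.sum_le_sum fun a ha => ?_).trans
    (Finset.sum_le_sum_of_subset (Finset.filter_subset _ _))
  exact card_sub_one_le_of_not_hasMaxTraceDim (Finset.mem_filter.1 ha).2

/-- If codewords of `C` with `κ` zeros vanish, then `C_a` has maximum trace dimension for a
proportion at least `1 - (|K| ^ κ - 1) / ((|k| - 1) |k| ^ n)` of the multiplier vectors `a`. -/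
theorem le_maxTraceDimProportion [Finite k] {C : Submodule K (Fin n → K)} {κ : ℕ} (hκ : κ ≤ n)
    (hC : ∀ x ∈ C, ∀ T : Finset (Fin n), T.card = κ → (∀ i ∈ T, x i = 0) → x = 0) :
    1 - ((Nat.card K : ℝ) ^ κ - 1) / (((Nat.card k : ℝ) - 1) * (Nat.card k : ℝ) ^ n) ≤
      maxTraceDimProportion k C := by
  classical
  have : Fintype C := Fintype.ofFinite C
  have hq : (1 : ℝ) < Nat.card k := by exact_mod_cast Finite.one_lt_card (α := k)
  have hQ : (1 : ℝ) < Nat.card K := by exact_mod_cast Finite.one_lt_card (α := K)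
  have hqQ : (Nat.card k : ℝ) ≤ Nat.card K := by
    exact_mod_cast Nat.card_le_card_of_injective _ (algebraMap k K).injective
  have hUQ : (Nat.card Kˣ : ℝ) = Nat.card K - 1 := by
    rw [Nat.card_units, Nat.cast_sub Nat.card_pos, Nat.cast_one]
  have hbad := card_not_hasMaxTraceDim_mul_le (k := k) C
  have hsum := fun ρ => sum_pow_weight_le (ρ := ρ) hκ hC
  have hN := card_multipliers_trace_eq_zero (k := k) (K := K) (n := n)
  set q := (Nat.card k : ℝ)
  set Q := (Nat.card K : ℝ)
  set U := (Nat.card Kˣ : ℝ) with hU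
  have hU0 : 0 < U := by rw [hUQ]; linarith
  -- The probability that a uniform unit of `K` has trace zero; `hbase` adds the zero element back,
  -- giving 1/q over all of `K`.
  set ρ : ℝ := (Q / q - 1) / U with hρ
  have hρ0 : 0 ≤ ρ := div_nonneg (by rw [sub_nonneg, one_le_div (by linarith)]; exact hqQ) hU0.le
  have hρ1 : ρ ≤ 1 := by
    rw [hρ, div_le_one hU0, hUQ, sub_le_sub_iff_right]
    exact div_le_self (by linarith) hq.le
  have hbase : (1 - ρ) * Q⁻¹ + ρ = q⁻¹ := by
    have : Q - 1 ≠ 0 := by linarith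
    rw [hρ, hUQ]
    field_simp
    ring
  replace hsum := hsum ρ hρ0 hρ1
  have hterm (x : C) : (Nat.card {a : Fin n → Kˣ //
      ∀ i, Algebra.trace k K (a i * x.1 i) = 0} : ℝ) =
      U ^ n * ρ ^ (n - (zeroSet x.1).card) := by
    have hle : (zeroSet x.1).card ≤ n := (Finset.card_le_univ _).trans (by simp)
    rw [hN, hρ, div_pow]
    have e : U ^ n = U ^ (n - (zeroSet x.1).card) * U ^ (zeroSet x.1).card := by
      rw [← pow_add, Nat.sub_add_cancel hle]
    rw [e]
    field_simp
  simp_rw [hterm] at hbad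
  rw [← Finset.mul_sum] at hbad
  rw [hbase] at hsum
  have htot : (Nat.card {a : Fin n → Kˣ // HasMaxTraceDim k (multiplierCode C fun i => (a i : K))} :
      ℝ) + Nat.card {a : Fin n → Kˣ // ¬ HasMaxTraceDim k (multiplierCode C fun i => (a i : K))} =
      U ^ n := by
    have : Fintype Kˣ := Fintype.ofFinite _
    have h := Fintype.card_subtype_compl
      (fun a : Fin n → Kˣ => HasMaxTraceDim k (multiplierCode C fun i => (a i : K)))
    have h' := Fintype.card_subtype_le
      (fun a : Fin n → Kˣ => HasMaxTraceDim k (multiplierCode C fun i => (a i : K)))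
    have e : Fintype.card (Fin n → Kˣ) = Nat.card Kˣ ^ n := by
      rw [← Nat.card_eq_fintype_card, Nat.card_fun, Nat.card_eq_fintype_card (α := Fin n),
        Fintype.card_fin]
    rw [e] at h h'
    rw [Nat.card_eq_fintype_card, Nat.card_eq_fintype_card, h, Nat.cast_sub h', hU]
    push_cast
    ring
  have hcard : (Nat.card (Fin n → Kˣ) : ℝ) = U ^ n := by
    rw [Nat.card_fun, Nat.card_eq_fintype_card (α := Fin n), Fintype.card_fin, Nat.cast_pow]
  have hUn : 0 < U ^ n := by positivity
  have hq1 : 0 < q - 1 := by linarith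
  have hqn : 0 < q ^ n := by positivity
  rw [maxTraceDimProportion, hcard, eq_sub_of_add_eq htot, sub_div (U ^ n), div_self hUn.ne',
    sub_le_sub_iff_left, div_le_div_iff₀ hUn (by positivity)]
  calc _ = (_ * (q - 1)) * q ^ n := (mul_assoc _ _ _).symm
    _ ≤ (U ^ n * ((Q ^ κ - 1) * q⁻¹ ^ n)) * q ^ n :=
        mul_le_mul_of_nonneg_right
          (hbad.trans (mul_le_mul_of_nonneg_left hsum hUn.le)) hqn.le
    _ = _ := by rw [inv_pow]; field_simp

end Counting

/-! ### Separability over K(f) and p-th powers. -/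

section FieldTheory

open IntermediateField

theorem essFiniteType_of_functionField (K F : Type*) [Field K] [Field F] [Algebra K F]
    [Algebra (RatFunc K) F] [IsScalarTower K (RatFunc K) F] [FunctionField K F] :
    Algebra.EssFiniteType K F := by
  have : Algebra.EssFiniteType (Polynomial K) (RatFunc K) :=
    .of_isLocalization _ (nonZeroDivisors (Polynomial K))
  have : Algebra.EssFiniteType K (RatFunc K) := .comp K (Polynomial K) (RatFunc K)
  exact .comp K (RatFunc K) F

theorem trdeg_functionField (K F : Type*) [Field K] [Field F] [Algebra K F]
    [Algebra (RatFunc K) F] [IsScalarTower K (RatFunc K) F] [FunctionField K F] :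
    Algebra.trdeg K F = 1 := by
  have h1 : Algebra.trdeg K (RatFunc K) = 1 := by
    have : Algebra.IsAlgebraic (Polynomial K) (RatFunc K) :=
      IsLocalization.isAlgebraic _ (nonZeroDivisors (Polynomial K))
    rw [← _root_.trdeg_add_eq K (Polynomial K) (A := RatFunc K), Polynomial.trdeg_of_isDomain,
      trdeg_eq_zero, add_zero]
  have h := _root_.lift_trdeg_add_eq K (RatFunc K) F
  rw [h1, trdeg_eq_zero (R := RatFunc K)] at h
  simpa using h.symm

variable {K F : Type*} [Field K] [Field F] [Algebra K F] [Algebra.EssFiniteType K F]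

/-- In transcendence degree one, f alone is a transcendence basis; a finitely generated algebraic
field extension is finite. -/
theorem finiteDimensional_adjoin_of_transcendental (h : Algebra.trdeg K F = 1) {f : F}
    (hf : Transcendental K f) : FiniteDimensional K⟮f⟯ F := by
  have hi : AlgebraicIndependent K (fun _ : Unit => f) :=
    algebraicIndependent_unique_type_iff.2 hf
  have hb := hi.isTranscendenceBasis_of_lift_trdeg_le_of_finite (by simp [h])
  have := hb.isAlgebraic_field
  rw [Set.range_const] at this
  have : Algebra.EssFiniteType K⟮f⟯ F := .of_comp K _ _
  exact Algebra.finite_of_essFiniteType_of_isAlgebraic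

theorem exists_isSeparable_adjoin [PerfectField K] (h : Algebra.trdeg K F = 1) :
    ∃ x : F, Transcendental K x ∧ Algebra.IsSeparable K⟮x⟯ F := by
  obtain ⟨s, hs, hsep⟩ := exists_isTranscendenceBasis_and_isSeparable_of_perfectField (k := K) (K := F)
  have hc := hs.cardinalMk_eq_trdeg
  rw [h, Cardinal.mk_coe_finset, Nat.cast_eq_one, Finset.card_eq_one] at hc
  obtain ⟨x, rfl⟩ := hc
  refine ⟨x, ?_, by rwa [Finset.coe_singleton] at hsep⟩
  exact hs.1.transcendental ⟨x, by simp⟩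

/-- The subfield of `p`-th powers of an extension of a perfect field of characteristic `p`. -/
def pthPowers (K F : Type*) [Field K] [Field F] [Algebra K F] (p : ℕ) [ExpChar K p] [ExpChar F p]
    [PerfectRing K p] : IntermediateField K F :=
  { (frobenius F p).fieldRange with
    algebraMap_mem' := fun c => ⟨algebraMap K F ((frobeniusEquiv K p).symm c), by
      rw [frobenius_def, ← map_pow, frobeniusEquiv_symm_pow_p]⟩ }

variable (p : ℕ) [ExpChar K p] [ExpChar F p] [PerfectRing K p]

omit [Algebra.EssFiniteType K F] in
theorem mem_pthPowers {f : F} : f ∈ pthPowers K F p ↔ ∃ g, g ^ p = f := Iff.rfl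

-- Separability over K(x) means that the p-th powers already generate F over K(x), and F^p contains
-- `K` because `K` is perfect.
omit [Algebra.EssFiniteType K F] in
theorem adjoin_pthPowers_eq_top {x : F} [Algebra.IsSeparable K⟮x⟯ F] :
    (pthPowers K F p)⟮x⟯ = ⊤ := by
  have : ExpChar K⟮x⟯ p := expChar_of_injective_algebraMap (algebraMap K K⟮x⟯).injective p
  rw [eq_top_iff]
  have h := adjoin_eq_adjoin_pow_expChar_of_isSeparable' K⟮x⟯ F Set.univ p
  intro z _
  have hz : z ∈ adjoin K⟮x⟯ ((· ^ p) '' (Set.univ : Set F)) := by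
    rw [← h]; exact subset_adjoin _ _ trivial
  refine adjoin_induction (p := fun z _ => z ∈ (pthPowers K F p)⟮x⟯) K⟮x⟯ ?_ ?_
    (fun _ _ _ _ => add_mem) (fun _ _ => inv_mem) (fun _ _ _ _ => mul_mem) hz
  · rintro _ ⟨g, -, rfl⟩
    exact IntermediateField.algebraMap_mem (pthPowers K F p)⟮x⟯ (⟨g ^ p, g, rfl⟩ : pthPowers K F p)
  · rintro ⟨y, hy⟩
    have hle : K⟮x⟯ ≤ ((pthPowers K F p)⟮x⟯).restrictScalars K :=
      adjoin_simple_le_iff.2 (mem_adjoin_simple_self _ x)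
    exact hle hy

-- Since F = F^p(x), the degree [F : F^p] is at most p. If f is not a p-th power, X^p - f^p is
-- irreducible over F^p, so F^p(f) already has degree p.
omit [Algebra.EssFiniteType K F] in
theorem adjoin_pthPowers_eq_top_of_notMem (hp : p.Prime) {x : F} [Algebra.IsSeparable K⟮x⟯ F]
    {f : F} (hf : f ∉ pthPowers K F p) : (pthPowers K F p)⟮f⟯ = ⊤ := by
  set M := pthPowers K F p
  have hpow (z : F) : z ^ p ∈ M := ⟨z, rfl⟩
  have hint (z : F) : IsIntegral M z :=
    ⟨Polynomial.X ^ p - Polynomial.C ⟨z ^ p, hpow z⟩, Polynomial.monic_X_pow_sub_C _ hp.ne_zero,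
      by simp⟩
  have hdeg (z : F) : (minpoly M z).natDegree ≤ p := by
    refine (Polynomial.natDegree_le_of_dvd (minpoly.dvd M z
      (p := Polynomial.X ^ p - Polynomial.C ⟨z ^ p, hpow z⟩) ?_)
      (Polynomial.monic_X_pow_sub_C _ hp.ne_zero).ne_zero).trans_eq
      Polynomial.natDegree_X_pow_sub_C
    simp
  have htop : M⟮x⟯ = ⊤ := adjoin_pthPowers_eq_top p
  have hF : Module.finrank M F ≤ p := by
    rw [← finrank_top', ← htop, adjoin.finrank (hint x)]
    exact hdeg x
  have : FiniteDimensional M (⊤ : IntermediateField M F) := by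
    rw [← htop]; exact adjoin.finiteDimensional (hint x)
  have : FiniteDimensional M F := topEquiv.toLinearEquiv.finiteDimensional
  have hirr : Irreducible (Polynomial.X ^ p - Polynomial.C (⟨f ^ p, hpow f⟩ : M)) := by
    refine X_pow_sub_C_irreducible_of_prime hp fun b hb => hf ?_
    have : (b : F) ^ p = f ^ p := congrArg Subtype.val hb
    rw [← frobenius_inj F p this]
    exact b.2
  have hmin := minpoly.eq_of_irreducible_of_monic hirr (x := f) (by simp)
    (Polynomial.monic_X_pow_sub_C _ hp.ne_zero)
  have hfr : Module.finrank M M⟮f⟯ = p := by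
    rw [adjoin.finrank (hint f), ← hmin, Polynomial.natDegree_X_pow_sub_C]
  refine eq_of_le_of_finrank_le le_top ?_
  rw [finrank_top', hfr]
  exact hF

/-- A derivation over K(f) kills f and all p-th powers, hence all of F = F^p(f). So the Kähler
differentials of F/K(f) vanish, which is separability for a finitely generated extension. -/
theorem isSeparable_of_notMem_pthPowers (hp : p.Prime) {x : F} [Algebra.IsSeparable K⟮x⟯ F]
    {f : F} (hf : f ∉ pthPowers K F p) : Algebra.IsSeparable K⟮f⟯ F := by
  have htop := adjoin_pthPowers_eq_top_of_notMem p hp (x := x) hf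
  have : Algebra.EssFiniteType K⟮f⟯ F := .of_comp K _ _
  rw [← Algebra.FormallyUnramified.iff_isSeparable]
  have hchar : CharP F p := by
    rcases ‹ExpChar F p› with _ | _
    · exact absurd hp Nat.not_prime_one
    · assumption
  have hD (z : F) : KaehlerDifferential.D K⟮f⟯ F z = 0 := by
    have hz : z ∈ (pthPowers K F p)⟮f⟯ := htop ▸ mem_top
    refine adjoin_induction (p := fun z _ => KaehlerDifferential.D K⟮f⟯ F z = 0) _ ?_ ?_ ?_ ?_ ?_ hz
    · intro z hz
      rw [Set.mem_singleton_iff.1 hz]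
      exact (KaehlerDifferential.D K⟮f⟯ F).map_algebraMap (AdjoinSimple.gen K f)
    · rintro ⟨_, g, rfl⟩
      change KaehlerDifferential.D K⟮f⟯ F (g ^ p) = 0
      rw [Derivation.leibniz_pow, ← Nat.cast_smul_eq_nsmul F, CharP.cast_eq_zero, zero_smul]
    · intro a b _ _ ha hb; rw [map_add, ha, hb, add_zero]
    · intro a _ ha; rw [Derivation.leibniz_inv, ha, smul_zero]
    · intro a b _ _ ha hb; rw [Derivation.leibniz, ha, hb, smul_zero, smul_zero, add_zero]
  refine ⟨?_⟩
  rw [← Submodule.subsingleton_iff F, ← subsingleton_iff_bot_eq_top, ← KaehlerDifferential.span_range_derivation,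
    eq_comm, Submodule.span_eq_bot]
  rintro _ ⟨z, rfl⟩
  exact hD z

end FieldTheory

/-! ### Places and maximal ideals of a Dedekind domain. -/

section Places

open IsDedekindDomain

/-- Equivalent surjective `ℤ`-valued valuations agree. -/
theorem valuation_eq_of_isEquiv {F : Type*} [Field F] {v w : Valuation F ℤᵐ⁰}
    (hv : Function.Surjective v) (hw : Function.Surjective w) (h : v.IsEquiv w) : v = w := by
  -- No value lies strictly between `exp (-1)` and 1, so a uniformizer of `v` is one of `w`, and its
  -- powers determine both valuations.
  have step {z : ℤᵐ⁰} (hz : z < 1) : z ≤ WithZero.exp (-1 : ℤ) := by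
    rcases eq_or_ne z 0 with rfl | h0
    · exact zero_le
    · rw [← WithZero.log_le_iff_le_exp h0]
      rw [← WithZero.exp_zero, ← WithZero.log_lt_iff_lt_exp h0] at hz
      omega
  have hlt : WithZero.exp (-1 : ℤ) < (1 : ℤᵐ⁰) := by
    rw [← WithZero.exp_zero, WithZero.exp_lt_exp]; omega
  have heq {x y : F} : v x = v y ↔ w x = w y := by
    rw [le_antisymm_iff, le_antisymm_iff, h x y, h y x]
  obtain ⟨ϖ, hϖ⟩ := hv (WithZero.exp (-1 : ℤ))
  obtain ⟨π, hπ⟩ := hw (WithZero.exp (-1 : ℤ))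
  have h1 : w ϖ ≤ w π := by
    rw [hπ]; exact step (h.lt_one_iff_lt_one.1 (hϖ ▸ hlt))
  have h2 : v π ≤ v ϖ := by
    rw [hϖ]; exact step (h.lt_one_iff_lt_one.2 (hπ ▸ hlt))
  have h3 : w ϖ = WithZero.exp (-1 : ℤ) := by
    rw [← hπ]; exact heq.1 (le_antisymm ((h _ _).2 h1) h2)
  ext x
  rcases eq_or_ne x 0 with rfl | hx
  · simp
  have hx' : v x ≠ 0 := v.ne_zero_iff.2 hx
  have hpow : v x = v (ϖ ^ (-WithZero.log (v x))) := by
    rw [map_zpow₀, hϖ, ← WithZero.exp_zsmul]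
    simp [WithZero.exp_log hx']
  rw [heq.1 hpow, map_zpow₀, h3, ← hϖ, ← map_zpow₀, ← hpow]

variable {K F : Type*} [Field K] [Field F] [Algebra K F]

namespace Place

theorem valuation_le_one_iff (P : Place K F) {x : F} : P.valuation x ≤ 1 ↔ x ∈ P.ring := by
  constructor
  · intro h
    obtain ⟨y, rfl⟩ := IsDiscreteValuationRing.exists_lift_of_le_one h
    exact y.2
  · intro h
    exact (IsDiscreteValuationRing.maximalIdeal P.ring).valuation_le_one (⟨x, h⟩ : P.ring)

theorem residue_eq_zero_iff (P : Place K F) {x : F} (h : x ∈ P.ring) :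
    IsLocalRing.residue P.ring ⟨x, h⟩ = 0 ↔ P.valuation x < 1 := by
  rw [IsLocalRing.residue_eq_zero_iff]
  exact ((IsDiscreteValuationRing.maximalIdeal P.ring).valuation_lt_one_iff_mem
    (K := F) (⟨x, h⟩ : P.ring)).symm

theorem valuation_surjective (P : Place K F) : Function.Surjective P.valuation :=
  (IsDiscreteValuationRing.maximalIdeal P.ring).valuation_surjective F

theorem ord_pos_iff (P : Place K F) {f : F} (hf : f ≠ 0) : 0 < P.ord f ↔ P.valuation f < 1 := by
  rw [ord, neg_pos, ← WithZero.exp_zero,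
    WithZero.log_lt_iff_lt_exp ((Valuation.ne_zero_iff P.valuation).2 hf)]

theorem ord_inv (P : Place K F) (f : F) : P.ord f⁻¹ = -P.ord f := by
  rw [ord, map_inv₀, WithZero.log_inv]
  rfl

theorem ord_pow (P : Place K F) (f : F) (n : ℕ) : P.ord (f ^ n) = n * P.ord f := by
  rw [ord, map_pow, WithZero.log_pow, ord]
  simp

/-- Functions integral over functions regular at `P` are regular at `P`. -/
theorem mem_ring_of_isIntegral (P : Place K F) {R : Type*} [CommRing R] [Algebra R F]
    (hR : ∀ r : R, algebraMap R F r ∈ P.ring) {x : F} (hx : IsIntegral R x) : x ∈ P.ring := by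
  let _ : Algebra R P.ring := ((algebraMap R F).codRestrict P.ring hR).toAlgebra
  have : IsScalarTower R P.ring F := .of_algebraMap_eq fun _ => rfl
  have hx' : IsIntegral P.ring x := hx.tower_top
  obtain ⟨y, rfl⟩ := IsIntegrallyClosed.isIntegral_iff.1 hx'
  exact y.2

variable {B : Type*} [CommRing B] [IsDedekindDomain B] [Algebra K B] [Algebra B F]
  [IsFractionRing B F] [IsScalarTower K B F]

/-- The place defined by a maximal ideal of a Dedekind domain. -/
def ofPrime (v : HeightOneSpectrum B) : Place K F where
  ring := HeightOneSpectrum.valuationSubringAtPrime F v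
  algebraMap_mem c := by
    rw [HeightOneSpectrum.valuationSubringAtPrime_eq_valuationSubring,
      Valuation.mem_valuationSubring_iff, IsScalarTower.algebraMap_apply K B F]
    exact v.valuation_le_one _
  isDVR := IsLocalization.AtPrime.isDiscreteValuationRing_of_dedekind_domain B v.ne_bot _

theorem valuation_ofPrime (v : HeightOneSpectrum B) :
    (ofPrime v : Place K F).valuation = v.valuation F := by
  refine valuation_eq_of_isEquiv (valuation_surjective _) (v.valuation_surjective F)
    (Valuation.isEquiv_iff_val_le_one.2 fun {x} => ?_)
  rw [valuation_le_one_iff, ← Valuation.mem_valuationSubring_iff,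
    ← HeightOneSpectrum.valuationSubringAtPrime_eq_valuationSubring]
  rfl

/-- The hypotheses put the localization at `v` inside the ring of `P`; a discrete valuation ring has
no overring in F besides itself and F. -/
theorem eq_ofPrime (P : Place K F) (v : HeightOneSpectrum B)
    (h : ∀ b : B, P.valuation (algebraMap B F b) ≤ 1)
    (hv : ∀ b ∉ v.asIdeal, P.valuation (algebraMap B F b) = 1) : P = ofPrime v := by
  have hle : (ofPrime v : Place K F).ring ≤ P.ring := by
    intro x hx
    rw [← valuation_le_one_iff, valuation_ofPrime] at hx
    obtain ⟨n, d, hnd⟩ := HeightOneSpectrum.exists_primeCompl_mul_eq_of_integer v x hx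
    rw [← valuation_le_one_iff, ← mul_one (P.valuation x)]
    exact (congrArg (P.valuation x * ·) (hv d d.2).symm).trans_le
      ((map_mul _ _ _).symm.trans_le (hnd ▸ h n))
  refine Place.ext (ValuationSubring.eq_of_le_of_ne_top
    (A := HeightOneSpectrum.valuationSubringAtPrime F v) hle fun htop => ?_).symm
  obtain ⟨x, hx⟩ := P.valuation_surjective (WithZero.exp 1)
  have hmem : x ∈ P.ring := htop ▸ ValuationSubring.mem_top x
  rw [← valuation_le_one_iff, hx, ← WithZero.exp_zero, WithZero.exp_le_exp] at hmem
  omega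

theorem deg_ofPrime (v : HeightOneSpectrum B) :
    (ofPrime v : Place K F).deg = Module.finrank K (B ⧸ v.asIdeal) := by
  set P : Place K F := ofPrime v with hP
  have hmem (b : B) : algebraMap B F b ∈ P.ring := by
    rw [← valuation_le_one_iff, hP, valuation_ofPrime]
    exact v.valuation_le_one b
  let φ : B →ₐ[K] P.ResidueField :=
    { (IsLocalRing.residue P.ring).comp ((algebraMap B F).codRestrict P.ring hmem) with
      commutes' := fun c => congrArg (IsLocalRing.residue P.ring)
        (Subtype.ext (IsScalarTower.algebraMap_apply K B F c).symm) }
  have hφ (b : B) : φ b = IsLocalRing.residue P.ring ⟨algebraMap B F b, hmem b⟩ := rfl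
  have hker : RingHom.ker φ = v.asIdeal := by
    ext b
    rw [RingHom.mem_ker, hφ, residue_eq_zero_iff, hP, valuation_ofPrime,
      HeightOneSpectrum.valuation_lt_one_iff_mem]
  have hsurj : Function.Surjective φ := by
    intro z
    obtain ⟨⟨x, hx⟩, rfl⟩ := IsLocalRing.residue_surjective z
    have hx' := hx
    rw [← valuation_le_one_iff, hP, valuation_ofPrime] at hx'
    obtain ⟨n, d, hnd⟩ := HeightOneSpectrum.exists_primeCompl_mul_eq_of_integer v x hx'
    have hd : φ d ≠ 0 := by
      rw [Ne, ← RingHom.mem_ker, hker]; exact d.2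
    have hmax : v.asIdeal.IsMaximal := v.isMaximal
    obtain ⟨e, he⟩ := hmax.exists_inv d.2
    obtain ⟨i, hi, he⟩ := he
    refine ⟨n * e, ?_⟩
    have h1 : φ n = IsLocalRing.residue P.ring ⟨x, hx⟩ * φ d := by
      rw [hφ, hφ, ← map_mul]
      exact congrArg _ (Subtype.ext hnd.symm)
    have hi' : φ i = 0 := by rwa [← RingHom.mem_ker, hker]
    have h2 : φ e * φ d = 1 := by
      rw [← map_mul, ← map_one φ, ← he, map_add, hi', add_zero]
    rw [map_mul, h1, mul_assoc, mul_comm (φ d), h2, mul_one]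
  rw [deg, ← hker]
  exact (Ideal.quotientKerAlgEquivOfSurjective hsurj).toLinearEquiv.finrank_eq.symm

end Place

end Places

/-! ### The number of zeros of a function. -/

section Zeros

open IsDedekindDomain IntermediateField
open scoped IntermediateField.algebraAdjoinAdjoin

variable {K F : Type*} [Field K] [Field F] [Algebra K F]

instance isPrincipalIdealRing_adjoin_singleton (y : F) :
    IsPrincipalIdealRing (Algebra.adjoin K {y}) := by
  let φ : Polynomial K →ₐ[K] Algebra.adjoin K {y} :=
    Polynomial.aeval ⟨y, Algebra.self_mem_adjoin_singleton K y⟩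
  refine IsPrincipalIdealRing.of_surjective φ.toRingHom fun ⟨z, hz⟩ => ?_
  have hz' := hz
  rw [Algebra.adjoin_singleton_eq_range_aeval] at hz'
  obtain ⟨g, hg⟩ := hz'
  exact ⟨g, Subtype.ext ((Polynomial.aeval_algHom_apply (Algebra.adjoin K {y}).val
    (⟨y, Algebra.self_mem_adjoin_singleton K y⟩ : Algebra.adjoin K {y}) g).symm.trans hg)⟩

namespace Place

variable {R B : Type*} [CommRing R] [IsDomain R] [CommRing B] [IsDedekindDomain B] [Algebra R B]
  [Algebra K B] [Algebra B F] [IsFractionRing B F] [IsScalarTower K B F] (v : HeightOneSpectrum B)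

/-- The prime below is generated by `r`, so its ramification index is the multiplicity of `v` in the
ideal generated by `r`. -/
theorem ord_ofPrime_algebraMap [Module.IsTorsionFree R B] {r : R} (hr : r ≠ 0)
    [v.asIdeal.LiesOver (Ideal.span {r})] :
    (ofPrime v : Place K F).ord (algebraMap B F (algebraMap R B r)) =
      v.asIdeal.ramificationIdx R := by
  have hp0 : Ideal.span {r} ≠ ⊥ := by rwa [Ne, Ideal.span_singleton_eq_bot]
  have hrB : algebraMap R B r ≠ 0 := by
    rwa [Ne, map_eq_zero_iff _ (FaithfulSMul.algebraMap_injective R B)]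
  rw [← Ideal.ramificationIdx'_eq_ramificationIdx (Ideal.span {r}) v.asIdeal hp0,
    Ideal.IsDedekindDomain.ramificationIdx'_eq_multiplicity
      (Ideal.map_ne_bot_of_ne_bot hp0) v.isPrime, Ideal.map_span, Set.image_singleton, ord,
    valuation_ofPrime, HeightOneSpectrum.valuation_of_algebraMap,
    HeightOneSpectrum.intValuation_eq_exp_neg_multiplicity _ hrB, WithZero.log_exp, neg_neg]

omit [IsDomain R] in
theorem deg_ofPrime_eq_inertiaDeg [Algebra K R] [IsScalarTower K R B] (p : Ideal R) [p.IsMaximal]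
    [v.asIdeal.LiesOver p] (hp : Module.finrank K (R ⧸ p) = 1) :
    (ofPrime v : Place K F).deg = v.asIdeal.inertiaDeg R := by
  have : v.asIdeal.IsMaximal := v.isMaximal
  let _ : Field (R ⧸ p) := Ideal.Quotient.field p
  rw [deg_ofPrime, Ideal.inertiaDeg_eq_of_isMaximal p v.asIdeal,
    ← Module.finrank_mul_finrank K (R ⧸ p) (B ⧸ v.asIdeal), hp, one_mul]

/-- The fundamental identity, in terms of places: the zeros of `r` when `R / (r) = K`. -/
theorem exists_sum_ord_zeros_eq_finrank [Algebra K R] [Algebra R F] [IsScalarTower K R B]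
    [IsScalarTower R B F] [Module.Finite R B] [Module.Flat R B] [Module.IsTorsionFree R B] {r : R}
    (hr : r ≠ 0) (hmax : (Ideal.span {r}).IsMaximal)
    (hdeg : Module.finrank K (R ⧸ Ideal.span {r}) = 1)
    (hgen : ∀ P : Place K F, algebraMap R F r ∈ P.ring → ∀ s, algebraMap R F s ∈ P.ring) :
    ∃ S : Finset (Place K F), (∀ P, P ∈ S ↔ P.valuation (algebraMap R F r) < 1) ∧
      ∑ P ∈ S, P.ord (algebraMap R F r) * P.deg = Module.finrank R B := by
  classical
  let p : Ideal R := Ideal.span {r}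
  have hp0 : p ≠ ⊥ := by rwa [Ne, Ideal.span_singleton_eq_bot]
  have _ : Fintype (p.primesOver B) := (Algebra.QuasiFinite.finite_primesOver p).fintype
  have hsum := Ideal.sum_ramification_inertia_eq_finrank (S := B) p
  have hrF : algebraMap R F r = algebraMap B F (algebraMap R B r) :=
    IsScalarTower.algebraMap_apply R B F r
  let v (q : p.primesOver B) : HeightOneSpectrum B :=
    ⟨q.1, inferInstance, Ideal.ne_bot_of_mem_primesOver hp0 q.2⟩
  have hv (q : p.primesOver B) : (v q).asIdeal = q.1 := rfl
  let f (q : p.primesOver B) : Place K F := Place.ofPrime (v q)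
  have hf : Function.Injective f := by
    intro q q' h
    have hval : (v q).valuation F = (v q').valuation F := by
      rw [← Place.valuation_ofPrime (K := K), ← Place.valuation_ofPrime (K := K)]
      exact congrArg Place.valuation h
    refine Subtype.ext (Ideal.ext fun b => ?_)
    rw [← hv, ← hv, ← (v q).valuation_lt_one_iff_mem (K := F), hval,
      (v q').valuation_lt_one_iff_mem]
  refine ⟨Finset.univ.image f, fun P => ⟨fun hP => ?_, fun hP => ?_⟩, ?_⟩
  · obtain ⟨q, -, rfl⟩ := Finset.mem_image.1 hP
    rw [Place.valuation_ofPrime, hrF, HeightOneSpectrum.valuation_lt_one_iff_mem, hv,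
      ← Ideal.mem_of_liesOver q.1 p]
    exact Ideal.mem_span_singleton_self r
  -- At a zero of `r` all of `R` is regular by `hgen`, hence so is `B`, valuation rings being
  -- integrally closed. The centre of `P` on `B` is then a prime above (r), and it determines `P`.
  · have hB (b : B) : P.valuation (algebraMap B F b) ≤ 1 := by
      rw [Place.valuation_le_one_iff]
      exact P.mem_ring_of_isIntegral (hgen P ((P.valuation_le_one_iff).1 hP.le))
        ((Algebra.IsIntegral.isIntegral (R := R) b).algebraMap)
    let 𝔓 : Ideal B := (IsLocalRing.maximalIdeal P.ring).comap
      ((algebraMap B F).codRestrict P.ring fun b => (P.valuation_le_one_iff).1 (hB b))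
    have h𝔓 (b : B) : b ∈ 𝔓 ↔ P.valuation (algebraMap B F b) < 1 := by
      rw [← P.residue_eq_zero_iff ((P.valuation_le_one_iff).1 (hB b)),
        IsLocalRing.residue_eq_zero_iff]
      rfl
    have hprime : 𝔓.IsPrime := Ideal.comap_isPrime _ _
    have hover : 𝔓.LiesOver p := by
      refine ⟨hmax.eq_of_le (Ideal.IsPrime.under R 𝔓).ne_top ?_⟩
      rw [Ideal.span_singleton_le_iff_mem, Ideal.mem_under, h𝔓, ← hrF]
      exact hP
    refine Finset.mem_image.2 ⟨⟨𝔓, hprime, hover⟩, Finset.mem_univ _, ?_⟩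
    refine (Place.eq_ofPrime P _ hB fun b hb => ?_).symm
    exact le_antisymm (hB b) (not_lt.1 fun h => hb ((h𝔓 b).2 h))
  · rw [Finset.sum_image hf.injOn, ← hsum, Nat.cast_sum]
    refine Finset.sum_congr rfl fun q _ => ?_
    have hover : (v q).asIdeal.LiesOver (Ideal.span {r}) := q.2.2
    rw [Nat.cast_mul, hrF]
    exact congrArg₂ (fun (a : ℤ) (b : ℕ) => a * b)
      (Place.ord_ofPrime_algebraMap (K := K) (F := F) (v q) hr)
      (Place.deg_ofPrime_eq_inertiaDeg (R := R) (v q) p hdeg)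

end Place

/-- The ideal of `K[y]` generated by `y`. -/
def originIdeal (K : Type*) {F : Type*} [Field K] [Field F] [Algebra K F] (y : F) :
    Ideal (Algebra.adjoin K {y}) :=
  Ideal.span {⟨y, Algebra.self_mem_adjoin_singleton K y⟩}

theorem originIdeal_ne_top {y : F} (hy : Transcendental K y) : originIdeal K y ≠ ⊤ := by
  rw [originIdeal, Ne, Ideal.span_singleton_eq_top]
  intro h
  obtain ⟨⟨z, hz⟩, hyz⟩ := h.exists_right_inv
  rw [Algebra.adjoin_singleton_eq_range_aeval] at hz
  obtain ⟨g, rfl⟩ := hz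
  have h1 : y * Polynomial.aeval y g = 1 := congrArg Subtype.val hyz
  have h2 : Polynomial.X * g - 1 = 0 := by
    refine (transcendental_iff.1 hy) _ ?_
    simp [h1]
  have := congrArg (Polynomial.coeff · 0) h2
  simp at this

theorem quotient_originIdeal_algebraMap_surjective (y : F) :
    Function.Surjective (algebraMap K (Algebra.adjoin K {y} ⧸ originIdeal K y)) := by
  intro z
  obtain ⟨⟨z, hz⟩, rfl⟩ := Ideal.Quotient.mk_surjective z
  have hz' := hz
  rw [Algebra.adjoin_singleton_eq_range_aeval] at hz'
  obtain ⟨g, hg⟩ := hz'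
  refine ⟨g.coeff 0, ?_⟩
  rw [IsScalarTower.algebraMap_apply K (Algebra.adjoin K {y}), Ideal.Quotient.algebraMap_eq,
    eq_comm, Ideal.Quotient.mk_eq_mk_iff_sub_mem, originIdeal, Ideal.mem_span_singleton]
  refine ⟨⟨Polynomial.aeval y g.divX, ?_⟩, Subtype.ext ?_⟩
  · rw [Algebra.adjoin_singleton_eq_range_aeval]; exact ⟨_, rfl⟩
  · change z - algebraMap K F (g.coeff 0) = y * Polynomial.aeval y g.divX
    have e : Polynomial.aeval y g = y * Polynomial.aeval y g.divX + algebraMap K F (g.coeff 0) := by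
      conv_lhs => rw [← Polynomial.X_mul_divX_add g]
      rw [map_add, map_mul, Polynomial.aeval_X, Polynomial.aeval_C]
    exact sub_eq_of_eq_add (hg.symm.trans e)

theorem isMaximal_originIdeal {y : F} (hy : Transcendental K y) :
    (originIdeal K y).IsMaximal := by
  have : Nontrivial (Algebra.adjoin K {y} ⧸ originIdeal K y) :=
    Ideal.Quotient.nontrivial_iff.2 (originIdeal_ne_top hy)
  refine Ideal.Quotient.maximal_of_isField _ ?_
  exact (RingEquiv.ofBijective _ ⟨(algebraMap K _).injective,
    quotient_originIdeal_algebraMap_surjective y⟩).symm.toMulEquiv.isField (Field.toIsField K)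

theorem finrank_quotient_originIdeal {y : F} (hy : Transcendental K y) :
    Module.finrank K (Algebra.adjoin K {y} ⧸ originIdeal K y) = 1 := by
  have : Nontrivial (Algebra.adjoin K {y} ⧸ originIdeal K y) :=
    Ideal.Quotient.nontrivial_iff.2 (originIdeal_ne_top hy)
  rw [← Module.finrank_self K]
  exact (AlgEquiv.ofBijective (Algebra.ofId K _) ⟨(algebraMap K _).injective,
    quotient_originIdeal_algebraMap_surjective y⟩).toLinearEquiv.finrank_eq.symm

/-- A function has as many zeros, counted with multiplicity and degree, as the degree of the
function field over the field it generates. -/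
theorem exists_sum_ord_zeros_eq {y : F} (hy : Transcendental K y) [FiniteDimensional K⟮y⟯ F]
    [Algebra.IsSeparable K⟮y⟯ F] :
    ∃ S : Finset (Place K F), (∀ P, P ∈ S ↔ P.valuation y < 1) ∧
      ∑ P ∈ S, P.ord y * P.deg = Module.finrank K⟮y⟯ F := by
  let R := Algebra.adjoin K {y}
  let B := integralClosure R F
  have hy0 : y ≠ 0 := fun h => hy (h ▸ isAlgebraic_zero)
  have : IsDedekindDomain B := integralClosure.isDedekindDomain R K⟮y⟯ F
  have : IsFractionRing B F := integralClosure.isFractionRing_of_finite_extension K⟮y⟯ F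
  -- Separability is used here: it makes the integral closure finite over K[y]. It is then free,
  -- K[y] being principal, so its rank is [F : K(y)].
  have : Module.Finite R B := IsIntegralClosure.finite R K⟮y⟯ F B
  have : Module.IsTorsionFree R F := .trans_faithfulSMul R K⟮y⟯ F
  have : Module.Free R B := IsIntegralClosure.module_free R K⟮y⟯ F B
  have hfr : Module.finrank R B = Module.finrank K⟮y⟯ F := IsIntegralClosure.rank R K⟮y⟯ F B
  rw [← hfr]
  refine Place.exists_sum_ord_zeros_eq_finrank (R := R) (B := B)
    (r := ⟨y, Algebra.self_mem_adjoin_singleton K y⟩) (fun h => hy0 (congrArg Subtype.val h))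
    (isMaximal_originIdeal hy) (finrank_quotient_originIdeal hy) fun P hP s => ?_
  refine Algebra.adjoin_induction (p := fun z _ => z ∈ P.ring) ?_ P.algebraMap_mem
    (fun _ _ _ _ => P.ring.add_mem _ _) (fun _ _ _ _ => P.ring.mul_mem _ _) s.2
  intro z hz
  rw [Set.mem_singleton_iff.1 hz]
  exact hP

end Zeros

/-! ### Degrees of principal divisors and zeros of codewords. -/

section Divisors

open IntermediateField

variable {K F : Type*} [Field K] [Field F] [Algebra K F]

theorem Place.ord_eq_zero_of_isAlgebraic (P : Place K F) {f : F} (hf : IsAlgebraic K f) :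
    P.ord f = 0 := by
  rcases eq_or_ne f 0 with rfl | h0
  · simp [Place.ord]
  have h1 : P.valuation f ≤ 1 := P.valuation_le_one_iff.2
    (P.mem_ring_of_isIntegral P.algebraMap_mem hf.isIntegral)
  have h2 : P.valuation f⁻¹ ≤ 1 := P.valuation_le_one_iff.2
    (P.mem_ring_of_isIntegral P.algebraMap_mem hf.inv.isIntegral)
  have h3 : P.valuation f = 1 := by
    refine le_antisymm h1 ?_
    rwa [map_inv₀, inv_le_one₀ (zero_lt_iff.2 (P.valuation.ne_zero_iff.2 h0))] at h2
  rw [Place.ord, h3, WithZero.log_one, neg_zero]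

/-- The poles of f are the zeros of 1/f, and K(1/f) = K(f), so zeros and poles are both counted by
[F : K(f)]. -/
theorem exists_sum_ord_eq_zero_of_isSeparable {f : F} (hf : Transcendental K f)
    [FiniteDimensional K⟮f⟯ F] [Algebra.IsSeparable K⟮f⟯ F] :
    ∃ S : Finset (Place K F), (∀ P, P.ord f ≠ 0 → P ∈ S) ∧ ∑ P ∈ S, P.ord f * P.deg = 0 := by
  classical
  have hf0 : f ≠ 0 := fun h => hf (h ▸ isAlgebraic_zero)
  have hinv : K⟮f⁻¹⟯ = K⟮f⟯ := by
    refine le_antisymm (adjoin_simple_le_iff.2 (inv_mem (mem_adjoin_simple_self K f)))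
      (adjoin_simple_le_iff.2 ?_)
    simpa using inv_mem (mem_adjoin_simple_self K f⁻¹)
  have hf' : Transcendental K f⁻¹ := fun h => hf (by simpa using h.inv)
  have : FiniteDimensional K⟮f⁻¹⟯ F := by rw [hinv]; infer_instance
  have : Algebra.IsSeparable K⟮f⁻¹⟯ F := by rw [hinv]; infer_instance
  obtain ⟨S, hS, hsum⟩ := exists_sum_ord_zeros_eq hf
  obtain ⟨S', hS', hsum'⟩ := exists_sum_ord_zeros_eq hf'
  simp_rw [← Place.ord_pos_iff _ hf0] at hS
  simp_rw [← Place.ord_pos_iff _ (inv_ne_zero hf0), Place.ord_inv] at hS'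
  refine ⟨S ∪ S', fun P hP => ?_, ?_⟩
  · rw [Finset.mem_union, hS, hS']
    omega
  · rw [Finset.sum_union, hsum]
    · simp_rw [Place.ord_inv, neg_mul, Finset.sum_neg_distrib] at hsum'
      rw [hinv] at hsum'
      omega
    · rw [Finset.disjoint_left]
      intro P hP hP'
      rw [hS] at hP
      rw [hS'] at hP'
      omega

/-- Principal divisors have degree zero. -/
theorem exists_sum_ord_eq_zero [Finite K] [Algebra.EssFiniteType K F]
    (htr : Algebra.trdeg K F = 1) {f : F} (hf : f ≠ 0) :
    ∃ S : Finset (Place K F), (∀ P, P.ord f ≠ 0 → P ∈ S) ∧ ∑ P ∈ S, P.ord f * P.deg = 0 := by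
  by_cases hP : ∃ P₀ : Place K F, P₀.ord f ≠ 0
  swap
  · push Not at hP
    exact ⟨∅, fun P h => absurd (hP P) h, rfl⟩
  obtain ⟨P₀, hP₀⟩ := hP
  obtain ⟨p, hchar⟩ := CharP.exists K
  have hp : p.Prime := CharP.char_is_prime K p
  have _ : Fact p.Prime := ⟨hp⟩
  have _ : ExpChar K p := .prime hp
  have _ : ExpChar F p := expChar_of_injective_algebraMap (algebraMap K F).injective p
  obtain ⟨x, -, hx⟩ := exists_isSeparable_adjoin htr
  -- Replacing f by a p-th root divides its nonzero order at `P₀` by p, so the descent ends at a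
  -- function that is not a p-th power. The nonzero order also makes f transcendental.
  induction h : (P₀.ord f).natAbs using Nat.strong_induction_on generalizing f with
  | _ n ih =>
    by_cases hfp : f ∈ pthPowers K F p
    · obtain ⟨g, rfl⟩ := (mem_pthPowers p).1 hfp
      have hg : g ≠ 0 := by
        rintro rfl
        exact hf (zero_pow hp.ne_zero)
      rw [Place.ord_pow] at hP₀ h
      have hg₀ : P₀.ord g ≠ 0 := right_ne_zero_of_mul hP₀
      have hlt : (P₀.ord g).natAbs < n := by
        rw [← h, Int.natAbs_mul, Int.natAbs_natCast]
        exact lt_mul_of_one_lt_left (Int.natAbs_pos.2 hg₀) hp.one_lt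
      obtain ⟨S, hS, hsum⟩ := ih _ hlt hg hg₀ rfl
      refine ⟨S, fun P hP => hS P ?_, ?_⟩
      · rw [Place.ord_pow] at hP
        exact right_ne_zero_of_mul hP
      · simp_rw [Place.ord_pow, mul_assoc, ← Finset.mul_sum, hsum, mul_zero]
    · have htrans : Transcendental K f := fun h => hP₀ (P₀.ord_eq_zero_of_isAlgebraic h)
      have := finiteDimensional_adjoin_of_transcendental htr htrans
      have := isSeparable_of_notMem_pthPowers p hp (x := x) hfp
      exact exists_sum_ord_eq_zero_of_isSeparable htrans

/-- A nonzero function of `ℒ(G)` has at most `deg G` zeros off the support of `G`. -/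
theorem sum_deg_le_deg [Finite K] [Algebra.EssFiniteType K F] (htr : Algebra.trdeg K F = 1)
    {G : Divisor K F} {f : F} (hf : f ≠ 0) (hfG : f ∈ G.riemannRochSpace) (T : Finset (Place K F))
    (hT : ∀ P ∈ T, 0 < G P + P.ord f) : ∑ P ∈ T, (P.deg : ℤ) ≤ G.deg := by
  classical
  obtain ⟨S, hS, hsum⟩ := exists_sum_ord_eq_zero htr hf
  set U := S ∪ G.support ∪ T
  have hG : G.deg = ∑ P ∈ U, G P * P.deg :=
    Finsupp.sum_of_support_subset G (fun P hP => by simp [U, hP]) _ (by simp)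
  have hU : ∑ P ∈ U, P.ord f * P.deg = 0 := by
    rw [← hsum]
    refine (Finset.sum_subset (fun P hP => by simp [U, hP]) fun P _ hP => ?_).symm
    rw [not_not.1 (mt (hS P) hP), zero_mul]
  -- G has the same degree as G + div(f), whose coefficients are nonnegative everywhere and at least
  -- 1 on `T`.
  rw [hG, ← add_zero (∑ P ∈ U, _), ← hU, ← Finset.sum_add_distrib]
  have hnonneg (P : Place K F) : 0 ≤ G P + P.ord f := by
    have := hfG hf P
    omega
  refine (Finset.sum_le_sum fun P hP => ?_).trans (Finset.sum_le_sum_of_subset_of_nonneg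
    (fun P hP => by simp [U, hP] : T ⊆ U) fun P _ _ => ?_)
  · rw [← add_mul]
    exact le_mul_of_one_le_left (by positivity) (hT P hP)
  · rw [← add_mul]
    exact mul_nonneg (hnonneg P) (by positivity)

theorem Place.HasValue.eq_zero_of_zero {P : Place K F} {c : K} (h : P.HasValue 0 c) : c = 0 := by
  obtain ⟨h0, h⟩ := h
  rw [(P.residue_eq_zero_iff h0).2 (by simp)] at h
  exact (map_eq_zero _).1 h.symm

theorem Place.HasValue.ord_pos {P : Place K F} {f : F} (hf : f ≠ 0) (h : P.HasValue f 0) :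
    0 < P.ord f := by
  obtain ⟨h0, h⟩ := h
  rw [map_zero, P.residue_eq_zero_iff h0] at h
  exact (P.ord_pos_iff hf).2 h

/-- A codeword of `C_L(D, G)` with more than `deg G` zeros vanishes. -/
theorem eq_zero_of_mem_functionalCode [Finite K] [Algebra.EssFiniteType K F]
    (htr : Algebra.trdeg K F = 1) {n : ℕ} {P : Fin n → Place K F} (hP : Function.Injective P)
    (hP1 : ∀ i, (P i).deg = 1) {G : Divisor K F} (hG : ∀ i, P i ∉ G.support) {x : Fin n → K}
    (hx : x ∈ functionalCode P G) {T : Finset (Fin n)} (hT : G.deg < T.card)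
    (hxT : ∀ i ∈ T, x i = 0) : x = 0 := by
  classical
  obtain ⟨f, hfG, hfx⟩ := hx
  rcases eq_or_ne f 0 with rfl | hf
  · exact funext fun i => (hfx i).eq_zero_of_zero
  have h := sum_deg_le_deg htr hf hfG (T.image P) fun Q hQ => by
    obtain ⟨i, hi, rfl⟩ := Finset.mem_image.1 hQ
    have hv := hfx i
    rw [hxT i hi] at hv
    rw [Finsupp.notMem_support_iff.1 (hG i), zero_add]
    exact hv.ord_pos hf
  rw [Finset.sum_image hP.injOn] at h
  simp [hP1] at h
  omega

end Divisors

end AGCode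

end

theorem theorem2
    -- the finite fields `k = 𝔽_q` and `K = 𝔽_{q^m}`
    {k K : Type*} [Field k] [Field K] [Finite k] [Finite K] [Algebra k K]
    (q m : ℕ) (hq : Nat.card k = q) (hm : Module.finrank k K = m) (hm1 : 1 < m)
    -- `F` is an algebraic function field in one variable over `K`, with full constant field `K`
    -- (the function field of an absolutely irreducible smooth curve over `K`)
    {F : Type*} [Field F] [Algebra K F] [Algebra (RatFunc K) F] [IsScalarTower K (RatFunc K) F]
    [FunctionField K F] (hconst : algebraicClosure K F = ⊥)
    -- `D = P_1 + ⋯ + P_n` with distinct places of degree one, so that `n = deg D`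
    {n : ℕ} (P : Fin n → AGCode.Place K F) (hP : Function.Injective P)
    (hP1 : ∀ i, (P i).deg = 1)
    -- `G` has support disjoint from `D`
    (G : AGCode.Divisor K F) (hG : ∀ i, P i ∉ G.support)
    (hG1 : -1 ≤ G.deg) (hGn : (G.deg : ℝ) ≤ (n : ℝ) / (m : ℝ) - 1) :
    AGCode.maxTraceDimProportion k (AGCode.functionalCode P G) ≥
      1 - (1 - (q : ℝ) ^ (-((m : ℤ) * (G.deg + 1)))) /
        (((q : ℝ) - 1) * (q : ℝ) ^ ((n : ℤ) - (m : ℤ) * (G.deg + 1))) := by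
  have := AGCode.essFiniteType_of_functionField K F
  have htr := AGCode.trdeg_functionField K F
  -- The lower bound on deg G makes κ a natural number; the upper bound gives κ ≤ n/m ≤ n.
  obtain ⟨κ, hκ⟩ : ∃ κ : ℕ, G.deg + 1 = κ := ⟨_, (Int.toNat_of_nonneg (by omega)).symm⟩
  have hκ' : (G.deg : ℝ) = κ - 1 := by
    rw [eq_sub_iff_add_eq]; exact_mod_cast hκ
  have hκn : κ ≤ n := by
    have hm0 : (1 : ℝ) ≤ m := by exact_mod_cast hm1.le
    have h : (κ : ℝ) ≤ n / m := by linarith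
    exact_mod_cast h.trans (div_le_self (Nat.cast_nonneg n) hm0)
  refine (AGCode.le_maxTraceDimProportion (k := k) hκn fun x hx T hT hxT =>
    AGCode.eq_zero_of_mem_functionalCode htr hP hP1 hG hx (by omega) hxT).trans' (le_of_eq ?_)
  have hcard : (Nat.card K : ℝ) = (q : ℝ) ^ m := by
    rw [Module.natCard_eq_pow_finrank (K := k), hq, hm, Nat.cast_pow]
  have hq0 : (q : ℝ) ≠ 0 := by
    rw [← hq]; exact_mod_cast Nat.card_pos.ne'
  have hmκ : (m : ℤ) * κ = ((m * κ : ℕ) : ℤ) := by push_cast; rfl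
  -- Multiplying numerator and denominator of the stated fraction by q^(mκ) gives (Q^κ - 1) / ((q -
  -- 1) q^n).
  rw [hcard, hq, hκ, hmκ, zpow_neg, zpow_sub₀ hq0, zpow_natCast, zpow_natCast, ← pow_mul,
    mul_div_assoc', div_div_eq_mul_div, sub_mul, inv_mul_cancel₀ (pow_ne_zero _ hq0), one_mul]
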